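/- Let $X$ be a complete CAT(0) space of finite flat rank, i.e. the supremum of the dimensions $n$ of the Euclidean spaces $\mathbb{R}^n$ that embed isometrically in $X$ is finite. For an isometry $f$ of $X$ let $|f|:=\inf\{d(f(x),x)\mid x\in X\}$ be its translation length; $f$ is called semi-simple if this infimum is attained, and elliptic if moreover $|f|=0$. Let $\varphi\colon(\mathbb{R},+)\to\mathrm{Isom}(X)$ be a group homomorphism (not assumed continuous) such that $\varphi(r)$ is semi-simple for every $r\in\mathbb{R}$. If $$\inf\{|\varphi(r)|\;:\;r\in\mathbb{R},\ |\varphi(r)|>0\}>0$$ (with the convention $\inf\emptyset=+\infty$), then every element of $\varphi(\mathbb{R})$ is an elliptic isometry. -/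

import Mathlib

open Set

namespace CatZero

section Spaces

variable {X : Type*} [MetricSpace X]

/-- `α`, restricted to `[0, l]`, is a geodesic joining `x` and `y`. -/
def IsGeodesic (α : ℝ → X) (l : ℝ) (x y : X) : Prop :=
  0 ≤ l ∧ α 0 = x ∧ α l = y ∧
    ∀ t ∈ Icc (0 : ℝ) l, ∀ t' ∈ Icc (0 : ℝ) l, dist (α t) (α t') = |t - t'|

/-- `S` is a geodesic segment joining `x` and `y`: the image of some geodesic. -/
def IsGeodesicSegment (S : Set X) (x y : X) : Prop :=
  ∃ (α : ℝ → X) (l : ℝ), IsGeodesic α l x y ∧ S = α '' Icc (0 : ℝ) l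

/-- A geodesic triangle: three vertices `p 0, p 1, p 2` and a choice of three geodesic segments,
the side `S i` joining `p i` and `p (i + 1)` (indices modulo `3`). -/
def IsGeodesicTriangle (p : Fin 3 → X) (S : Fin 3 → Set X) : Prop :=
  ∀ i, IsGeodesicSegment (S i) (p i) (p (i + 1))

/-- The triangle in the Euclidean plane with vertices `q` is a comparison triangle for a geodesic
triangle with vertices `p`. -/
def IsComparisonTriangle (p : Fin 3 → X) (q : Fin 3 → EuclideanSpace ℝ (Fin 2)) : Prop :=
  ∀ i j, dist (p i) (p j) = dist (q i) (q j)

/-- `x'`, on the side `[q i, q (i + 1)]`, is a comparison point for the point `x` of the side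
joining `p i` and `p (i + 1)`. -/
def IsComparisonPoint (p : Fin 3 → X) (q : Fin 3 → EuclideanSpace ℝ (Fin 2)) (i : Fin 3)
    (x : X) (x' : EuclideanSpace ℝ (Fin 2)) : Prop :=
  x' ∈ segment ℝ (q i) (q (i + 1)) ∧ dist x (p i) = dist x' (q i)

/-- The CAT(0) inequality for the geodesic triangle with vertices `p` and sides `S`: distances
between points of the triangle do not exceed those between their comparison points. -/
def CATZeroInequality (p : Fin 3 → X) (S : Fin 3 → Set X) : Prop :=
  ∀ q : Fin 3 → EuclideanSpace ℝ (Fin 2), IsComparisonTriangle p q →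
    ∀ i j : Fin 3, ∀ x ∈ S i, ∀ y ∈ S j, ∀ x' y' : EuclideanSpace ℝ (Fin 2),
      IsComparisonPoint p q i x x' → IsComparisonPoint p q j y y' → dist x y ≤ dist x' y'

variable (X)

/-- Every two points are joined by a geodesic. -/
def IsGeodesicSpace : Prop :=
  ∀ x y : X, ∃ (α : ℝ → X) (l : ℝ), IsGeodesic α l x y

/-- A CAT(0) space: a geodesic space all of whose geodesic triangles satisfy the CAT(0)
inequality. -/
structure IsCATZero : Prop where
  geodesic : IsGeodesicSpace X
  inequality : ∀ (p : Fin 3 → X) (S : Fin 3 → Set X),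
    IsGeodesicTriangle p S → CATZeroInequality p S

/-- The flat rank: the supremum, in `ℕ ∪ {∞}`, of the dimensions `n` of the Euclidean spaces `ℝⁿ`
that embed isometrically in `X`. -/
noncomputable def flatRank : ℕ∞ :=
  ⨆ (n : ℕ) (_ : ∃ f : EuclideanSpace ℝ (Fin n) → X, Isometry f), (n : ℕ∞)

end Spaces

section Isometries

variable {X : Type*} [MetricSpace X]

/-- The translation length `|f| = inf {d(f x, x) | x ∈ X}`. -/
noncomputable def translationLength (f : X ≃ᵢ X) : ℝ :=
  ⨅ x : X, dist (f x) x

/-- The minset `Min(f)`: the points where the displacement function attains its infimum. -/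
def minSet (f : X ≃ᵢ X) : Set X :=
  {x | dist (f x) x = translationLength f}

def IsSemisimple (f : X ≃ᵢ X) : Prop :=
  (minSet f).Nonempty

def IsElliptic (f : X ≃ᵢ X) : Prop :=
  translationLength f = 0 ∧ (minSet f).Nonempty

/-- An action by isometries is semi-simple if each group element acts as a semi-simple isometry. -/
def IsSemisimpleAction {G : Type*} [Group G] (φ : G →* (X ≃ᵢ X)) : Prop :=
  ∀ g, IsSemisimple (φ g)

/-- The infimum of the nonzero translation lengths of the elements of `G`, as an extended real
number; it is `+∞` if there are none. -/
noncomputable def infPosTranslationLength {G : Type*} [Group G] (φ : G →* (X ≃ᵢ X)) : EReal :=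
  ⨅ (g : G) (_ : 0 < translationLength (φ g)), (translationLength (φ g) : EReal)

end Isometries

end CatZero

/-! If `φ r` had positive translation length, the lengths of `φ (r / 2 ^ n)` would be positive and
tend to 0, against the positive infimum. Halving `r` at least halves the length: when `f * f`
attains its infimum at `x`, test `f` on the midpoint of `[x, f x]` (`IsCATZero.dist_midpoints_le`).
Positivity survives because a semi-simple isometry of length 0 has a fixed point. -/

namespace CatZero

section Plane

/-- An isosceles triangle in the Euclidean plane with legs `l` and base `c`, the apex coming
first. -/
theorem exists_isosceles_triangle {l c : ℝ} (hl : 0 ≤ l) (hc : 0 ≤ c) (h : c ≤ 2 * l) :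
    ∃ a b b' : EuclideanSpace ℝ (Fin 2), dist a b = l ∧ dist b b' = c ∧ dist b' a = l := by
  have hs : Real.sqrt (l ^ 2 - (c / 2) ^ 2) ^ 2 = l ^ 2 - (c / 2) ^ 2 :=
    Real.sq_sqrt (by nlinarith)
  refine ⟨!₂[0, Real.sqrt (l ^ 2 - (c / 2) ^ 2)], !₂[c / 2, 0], !₂[-(c / 2), 0], ?_, ?_, ?_⟩
  · rw [EuclideanSpace.dist_eq, Real.sqrt_eq_iff_mul_self_eq (by positivity) hl]
    simp [Fin.sum_univ_two, Real.dist_eq, sq_abs, hs]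
    ring
  · rw [EuclideanSpace.dist_eq, Real.sqrt_eq_iff_mul_self_eq (by positivity) hc]
    simp [Fin.sum_univ_two, Real.dist_eq, sq_abs]
    ring
  · rw [EuclideanSpace.dist_eq, Real.sqrt_eq_iff_mul_self_eq (by positivity) hl]
    simp [Fin.sum_univ_two, Real.dist_eq, sq_abs, hs]
    ring

end Plane

section Midpoints

variable {X : Type*} [MetricSpace X]

theorem IsGeodesic.dist_eq {α : ℝ → X} {l : ℝ} {x y : X} (h : IsGeodesic α l x y) :
    dist x y = l := by
  obtain ⟨hl, h0, h1, hd⟩ := h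
  rw [← h0, ← h1, hd 0 ⟨le_rfl, hl⟩ l ⟨hl, le_rfl⟩, zero_sub, abs_neg, abs_of_nonneg hl]

theorem IsGeodesic.map {α : ℝ → X} {l : ℝ} {x y : X} (h : IsGeodesic α l x y) (f : X ≃ᵢ X) :
    IsGeodesic (f ∘ α) l (f x) (f y) := by
  obtain ⟨hl, rfl, rfl, hd⟩ := h
  exact ⟨hl, rfl, rfl, fun t ht t' ht' => by
    rw [← hd t ht t' ht']
    exact f.isometry.dist_eq _ _⟩

theorem IsGeodesic.dist_half {α : ℝ → X} {l : ℝ} {x y : X} (h : IsGeodesic α l x y) :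
    dist (α (l / 2)) x = l / 2 := by
  obtain ⟨hl, h0, -, hd⟩ := h
  rw [← h0, hd _ ⟨by linarith, by linarith⟩ 0 ⟨le_rfl, hl⟩, sub_zero,
    abs_of_nonneg (by linarith)]

/-- In an isosceles triangle of a CAT(0) space, the segment joining the midpoints of the two legs
is at most half as long as the base. -/
theorem IsCATZero.dist_midpoints_le (hX : IsCATZero X) {α β : ℝ → X} {l : ℝ} {x y z : X}
    (hα : IsGeodesic α l x y) (hβ : IsGeodesic β l y z) :
    dist (β (l / 2)) (α (l / 2)) ≤ dist z x / 2 := by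
  obtain ⟨γ, c, hγ⟩ := hX.geodesic z x
  have hl : 0 ≤ l := hα.1
  have hc : c ≤ 2 * l := by
    have := dist_triangle_left z x y
    rw [hγ.dist_eq, hβ.dist_eq, dist_comm, hα.dist_eq] at this
    linarith
  obtain ⟨a, b, b', hab, hbb', hba⟩ := exists_isosceles_triangle hl hγ.1 hc
  -- With the apex `y` first, the legs are sides 0 and 2.
  have hT : IsGeodesicTriangle ![y, z, x]
      ![β '' Icc 0 l, γ '' Icc 0 c, α '' Icc 0 l] := by
    intro i
    fin_cases i
    exacts [⟨β, l, hβ, rfl⟩, ⟨γ, c, hγ, rfl⟩, ⟨α, l, hα, rfl⟩]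
  have hq : IsComparisonTriangle ![y, z, x] ![a, b, b'] := by
    intro i j
    have h₁ := hα.dist_eq
    have h₂ := hβ.dist_eq
    have h₃ := hγ.dist_eq
    fin_cases i <;> fin_cases j <;>
      simp [*, dist_comm y x, dist_comm z y, dist_comm x z, dist_comm a b', dist_comm b a,
        dist_comm b' b]
  have hmem : l / 2 ∈ Icc 0 l := ⟨by linarith, by linarith⟩
  have key := hX.inequality _ _ hT _ hq 0 2 (β (l / 2)) ⟨_, hmem, rfl⟩ (α (l / 2))
    ⟨_, hmem, rfl⟩ (midpoint ℝ b a) (midpoint ℝ b' a)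
    ⟨by simpa [midpoint_comm] using midpoint_mem_segment (𝕜 := ℝ) a b, by
      change dist (β (l / 2)) y = dist (midpoint ℝ b a) a
      rw [hβ.dist_half, dist_midpoint_right, dist_comm b a, hab]
      norm_num; ring⟩
    ⟨midpoint_mem_segment b' a, by
      change dist (α (l / 2)) x = dist (midpoint ℝ b' a) b'
      rw [hα.dist_half, dist_midpoint_left, hba]
      norm_num; ring⟩
  -- The comparison midpoints lie on legs sharing the endpoint `a`, so this is the Euclidean midline
  -- bound.
  calc dist (β (l / 2)) (α (l / 2)) ≤ dist (midpoint ℝ b a) (midpoint ℝ b' a) := key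
    _ ≤ (dist b b' + dist a a) / 2 := dist_midpoint_midpoint_le _ _ _ _
    _ = dist z x / 2 := by rw [hbb', dist_self, add_zero, hγ.dist_eq]

end Midpoints

section TranslationLength

variable {X : Type*} [MetricSpace X]

theorem translationLength_le (f : X ≃ᵢ X) (x : X) : translationLength f ≤ dist (f x) x :=
  ciInf_le ⟨0, by rintro _ ⟨y, rfl⟩; exact dist_nonneg⟩ x

theorem translationLength_nonneg (f : X ≃ᵢ X) : 0 ≤ translationLength f :=
  Real.iInf_nonneg fun _ => dist_nonneg

/-- In a CAT(0) space, `2 |f| ≤ |f ^ 2|` if `f ^ 2` is semi-simple. -/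
theorem IsCATZero.translationLength_le_half (hX : IsCATZero X) (f : X ≃ᵢ X)
    (hf : IsSemisimple (f * f)) : translationLength f ≤ translationLength (f * f) / 2 := by
  obtain ⟨x, hx⟩ := hf
  obtain ⟨α, l, hα⟩ := hX.geodesic x (f x)
  rw [← show dist (f (f x)) x = translationLength (f * f) from hx]
  -- `f` maps the midpoint of `[x, f x]` to that of `[f x, f (f x)]`.
  exact (translationLength_le f (α (l / 2))).trans (hX.dist_midpoints_le hα (hα.map f))

/-- If the length of `f` were 0, it would be attained at a fixed point of `f`, which `f * f` also
fixes. -/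
theorem translationLength_pos_of_mul_self {f : X ≃ᵢ X} (hf : IsSemisimple f)
    (h : 0 < translationLength (f * f)) : 0 < translationLength f := by
  refine (translationLength_nonneg f).lt_of_ne fun h0 => h.not_ge ?_
  obtain ⟨x, hx⟩ := hf
  have hfix : f x = x := dist_eq_zero.1 (Eq.trans hx h0.symm)
  refine (translationLength_le (f * f) x).trans_eq ?_
  rw [IsometryEquiv.mul_apply, hfix, hfix, dist_self]

end TranslationLength

/-- Halving a real number halves the translation length, at least, and keeps it positive. -/
theorem IsCATZero.translationLength_div_two_pow {X : Type*} [MetricSpace X] (hX : IsCATZero X)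
    (φ : Multiplicative ℝ →* (X ≃ᵢ X)) (hss : IsSemisimpleAction φ) {r : ℝ}
    (hr : 0 < translationLength (φ (Multiplicative.ofAdd r))) (n : ℕ) :
    0 < translationLength (φ (Multiplicative.ofAdd (r / 2 ^ n))) ∧
      translationLength (φ (Multiplicative.ofAdd (r / 2 ^ n))) ≤
        translationLength (φ (Multiplicative.ofAdd r)) / 2 ^ n := by
  induction n with
  | zero => simpa using hr
  | succ n ih =>
    have hsq : φ (Multiplicative.ofAdd (r / 2 ^ n)) =
        φ (Multiplicative.ofAdd (r / 2 ^ (n + 1))) * φ (Multiplicative.ofAdd (r / 2 ^ (n + 1))) := by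
      rw [← map_mul, ← ofAdd_add]
      congr 2
      field_simp
      ring
    have hs := hss (Multiplicative.ofAdd (r / 2 ^ n))
    rw [hsq] at ih hs
    refine ⟨translationLength_pos_of_mul_self (hss _) ih.1,
      (hX.translationLength_le_half _ hs).trans ?_⟩
    rw [pow_succ (2 : ℝ) n, ← div_div (translationLength _)]
    simpa only [pow_succ] using div_le_div_of_nonneg_right ih.2 zero_le_two

end CatZero

theorem corollary4p5 {X : Type*} [MetricSpace X] [CompleteSpace X]
    (hX : CatZero.IsCATZero X) (hrank : CatZero.flatRank X < ⊤)
    (φ : Multiplicative ℝ →* (X ≃ᵢ X))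
    (hss : CatZero.IsSemisimpleAction φ)
    (hinf : 0 < CatZero.infPosTranslationLength φ) :
    ∀ r : ℝ, CatZero.IsElliptic (φ (Multiplicative.ofAdd r)) := by
  intro r
  refine ⟨?_, hss _⟩
  by_contra hne
  have hr := (CatZero.translationLength_nonneg (φ (Multiplicative.ofAdd r))).lt_of_ne' hne
  -- The infimum may be `⊤`, so a real bound below it is chosen.
  obtain ⟨ε, hε, hεinf⟩ := EReal.lt_iff_exists_real_btwn.1 hinf
  have hε0 : 0 < ε := EReal.coe_pos.1 hε
  obtain ⟨n, hn⟩ := pow_unbounded_of_one_lt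
    (CatZero.translationLength (φ (Multiplicative.ofAdd r)) / ε) one_lt_two
  obtain ⟨hpos, hle⟩ := hX.translationLength_div_two_pow φ hss hr n
  have hlt : ε < CatZero.translationLength (φ (Multiplicative.ofAdd (r / 2 ^ n))) :=
    EReal.coe_lt_coe_iff.1 (hεinf.trans_le (iInf₂_le (Multiplicative.ofAdd (r / 2 ^ n)) hpos))
  rw [div_lt_iff₀ hε0, mul_comm, ← div_lt_iff₀ (by positivity)] at hn
  exact (hlt.trans_le hle).not_gt hn
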